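/- Let $n \le 4$ and let $\mathcal{S}^n$ be the space of real symmetric $n \times n$ matrices with the trace inner product $\langle X, Y\rangle = \operatorname{tr}(XY)$. Let $CP_n \subseteq \mathcal{S}^n$ be the cone of completely positive matrices, that is, of matrices $BB^t$ with $B$ an entrywise nonnegative (not necessarily square) matrix. A linear map $L$ on $\mathcal{S}^n$ has the $\mathcal{Z}$-property relative to $CP_n$ if $$X \in CP_n,\quad Y \in CP_n^{*},\quad \langle X, Y\rangle = 0 \ \Longrightarrow\ \langle L(X), Y\rangle \le 0,$$ where $CP_n^{*} = \{Y \in \mathcal{S}^n : \langle X, Y\rangle \ge 0 \text{ for all } X \in CP_n\}$. **Theorem.** Let $L$ be a linear map on $\mathcal{S}^n$ such that $L(CP_n) \subseteq CP_n$. Then $L$ cannot have the $\mathcal{Z}$-property relative to $CP_n$, except in the trivial case where $L$ is a nonnegative scalar multiple of the identity. In other words, $L$ has the $\mathcal{Z}$-property relative to $CP_n$ if and only if there is a real $\alpha \ge 0$ with $L(X) = \alpha X$ for all $X \in \mathcal{S}^n$. -/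

import Mathlib

/-- The space `𝒮ⁿ` of real symmetric `n × n` matrices. -/
def SymMat (n : ℕ) : Submodule ℝ (Matrix (Fin n) (Fin n) ℝ) where
  carrier := {A | A.IsSymm}
  zero_mem' := Matrix.isSymm_zero
  add_mem' hA hB := Matrix.IsSymm.add hA hB
  smul_mem' c _ hA := Matrix.IsSymm.smul hA c

/-- The trace inner product `⟨X, Y⟩ = tr (X Y)` on `𝒮ⁿ`. -/
noncomputable def traceInner (n : ℕ) : LinearMap.BilinForm ℝ (SymMat n) :=
  LinearMap.mk₂ ℝ
    (fun X Y => Matrix.trace ((X : Matrix (Fin n) (Fin n) ℝ) * (Y : Matrix (Fin n) (Fin n) ℝ)))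
    (by intros; simp [Matrix.add_mul])
    (by intros; simp)
    (by intros; simp [Matrix.mul_add])
    (by intros; simp)

/-- The trace form is symmetric. -/
theorem traceInner_comm (n : ℕ) (X Y : SymMat n) :
    traceInner n X Y = traceInner n Y X := by
  simp only [traceInner, LinearMap.mk₂_apply]
  exact Matrix.trace_mul_comm _ _

/-- The trace form is positive definite on symmetric matrices. -/
theorem traceInner_self_pos (n : ℕ) (X : SymMat n) (hX : X ≠ 0) :
    0 < traceInner n X X := by
  have hs : Matrix.conjTranspose (X : Matrix (Fin n) (Fin n) ℝ) = X := by
    rw [Matrix.conjTranspose_eq_transpose_of_trivial]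
    exact X.2
  have h0 : (0 : ℝ) ≤ Matrix.trace (Matrix.conjTranspose (X : Matrix (Fin n) (Fin n) ℝ) * (X : Matrix (Fin n) (Fin n) ℝ)) :=
    (Matrix.posSemidef_conjTranspose_mul_self _).trace_nonneg
  have h1 : Matrix.trace (Matrix.conjTranspose (X : Matrix (Fin n) (Fin n) ℝ) * (X : Matrix (Fin n) (Fin n) ℝ)) ≠ 0 := by
    rw [Ne, Matrix.trace_conjTranspose_mul_self_eq_zero_iff]
    simpa using hX
  rw [hs] at h0 h1
  exact lt_of_le_of_ne h0 (Ne.symm h1)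

/-- The set `CPₙ` of completely positive matrices: symmetric matrices `A = B Bᵗ` with `B` an
entrywise nonnegative, not necessarily square, matrix. -/
def CP (n : ℕ) : Set (SymMat n) :=
  {A | ∃ (m : ℕ) (B : Matrix (Fin n) (Fin m) ℝ),
    (∀ i j, 0 ≤ B i j) ∧ (A : Matrix (Fin n) (Fin n) ℝ) = B * B.transpose}

/-- `L` has the `𝒵`-property relative to `K`, for the inner product `p` on `V`:
`x ∈ K`, `y ∈ K*` and `⟨x, y⟩ = 0` imply `⟨L x, y⟩ ≤ 0`.
Here `PointedCone.dual p K` is `K* = {y | ∀ x ∈ K, 0 ≤ ⟨x, y⟩}`. -/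
def HasZProperty {V : Type*} [AddCommGroup V] [Module ℝ V] (p : LinearMap.BilinForm ℝ V)
    (K : Set V) (L : V →ₗ[ℝ] V) : Prop :=
  ∀ x ∈ K, ∀ y ∈ PointedCone.dual p K, p x y = 0 → p (L x) y ≤ 0

/-! For `u ≥ 0`, the form `|u|² I - u uᵗ` lies in the dual cone and annihilates `u uᵗ`. The
`𝒵`-property makes its pairing with `L (u uᵗ)` nonpositive, and invariance of the cone makes it
nonnegative. Equality in Cauchy–Schwarz then puts `L (u uᵗ)` on the line of `u uᵗ`
(`HasZProperty.map_rankOne`). A linear relation among four such eigenvectors equates their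
eigenvalues (`exists_common_eigenvalue`), and these matrices span `𝒮ⁿ` (`eq_sum_rankOne`). -/

open Matrix in
/-- The rank-one symmetric matrix `u uᵗ`. -/
def rankOne {n : ℕ} (u : Fin n → ℝ) : SymMat n :=
  ⟨vecMulVec u u, Matrix.IsSymm.ext fun i j => by simp [vecMulVec_apply, mul_comm]⟩

theorem rankOne_apply {n : ℕ} (u : Fin n → ℝ) (i j : Fin n) :
    (rankOne u : Matrix (Fin n) (Fin n) ℝ) i j = u i * u j := rfl

theorem rankOne_mem_CP {n : ℕ} {u : Fin n → ℝ} (hu : ∀ i, 0 ≤ u i) : rankOne u ∈ CP n := by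
  refine ⟨1, Matrix.of fun i _ => u i, fun i _ => hu i, ?_⟩
  ext i j
  simp [rankOne_apply, Matrix.mul_apply]

/-- The positive semidefinite matrix `(uᵗu) I - u uᵗ`, whose kernel is the line of `u ≠ 0`. -/
def orthoComplForm {n : ℕ} (u : Fin n → ℝ) : SymMat n :=
  ⟨(u ⬝ᵥ u) • (1 : Matrix (Fin n) (Fin n) ℝ) - rankOne u,
    (Matrix.isSymm_one.smul _).sub (rankOne u).2⟩

theorem traceInner_orthoComplForm {n m : ℕ} (u : Fin n → ℝ) (A : SymMat n)
    (B : Matrix (Fin n) (Fin m) ℝ) (hA : (A : Matrix (Fin n) (Fin n) ℝ) = B * B.transpose) :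
    traceInner n A (orthoComplForm u) =
      ∑ k, ((u ⬝ᵥ u) * (B.col k ⬝ᵥ B.col k) - (u ⬝ᵥ B.col k) ^ 2) := by
  simp only [traceInner, LinearMap.mk₂_apply, orthoComplForm, hA]
  rw [Matrix.mul_sub, Matrix.trace_sub, Matrix.mul_smul, Matrix.mul_one, Matrix.trace_smul,
    Finset.sum_sub_distrib, ← Finset.mul_sum]
  congr 1
  · simp only [Matrix.trace, Matrix.diag, Matrix.mul_apply, dotProduct, smul_eq_mul,
      Matrix.transpose_apply, Matrix.col_apply]
    rw [Finset.sum_comm]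
  · have h : (rankOne u : Matrix (Fin n) (Fin n) ℝ) = Matrix.vecMulVec u u := rfl
    rw [h, Matrix.mul_vecMulVec, Matrix.trace_vecMulVec, ← Matrix.mulVec_mulVec,
      dotProduct_comm, Matrix.dotProduct_mulVec, ← Matrix.mulVec_transpose]
    simp only [dotProduct, Matrix.mulVec, Matrix.transpose_apply, Matrix.col_apply, pow_two]
    exact Finset.sum_congr rfl fun k _ => by simp only [mul_comm]

/-- Turns equality in Cauchy–Schwarz into proportionality: a zero deficit kills the vector on the
left. -/
theorem lagrange_identity_dotProduct {n : ℕ} (u b : Fin n → ℝ) :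
    ((u ⬝ᵥ u) • b - (u ⬝ᵥ b) • u) ⬝ᵥ ((u ⬝ᵥ u) • b - (u ⬝ᵥ b) • u) =
      (u ⬝ᵥ u) * ((u ⬝ᵥ u) * (b ⬝ᵥ b) - (u ⬝ᵥ b) ^ 2) := by
  simp only [sub_dotProduct, dotProduct_sub, smul_dotProduct, dotProduct_smul, smul_eq_mul,
    dotProduct_comm b u]
  ring

theorem dotProduct_cauchy_schwarz {n : ℕ} (u b : Fin n → ℝ) :
    0 ≤ (u ⬝ᵥ u) * (b ⬝ᵥ b) - (u ⬝ᵥ b) ^ 2 := by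
  have := Finset.sum_mul_sq_le_sq_mul_sq Finset.univ u b
  simp only [dotProduct, ← pow_two]
  linarith

theorem orthoComplForm_mem_dual {n : ℕ} (u : Fin n → ℝ) :
    orthoComplForm u ∈ PointedCone.dual (traceInner n) (CP n) := by
  rw [PointedCone.mem_dual]
  rintro A ⟨m, B, -, hA⟩
  rw [traceInner_orthoComplForm u A B hA]
  exact Finset.sum_nonneg fun k _ => dotProduct_cauchy_schwarz u _

theorem traceInner_rankOne_orthoComplForm {n : ℕ} (u : Fin n → ℝ) :
    traceInner n (rankOne u) (orthoComplForm u) = 0 := by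
  rw [traceInner_orthoComplForm u (rankOne u) (Matrix.of fun i (_ : Fin 1) => u i)
    (by ext i j; simp [rankOne_apply, Matrix.mul_apply])]
  have h : (Matrix.of fun i (_ : Fin 1) => u i).col 0 = u := rfl
  simp [h, pow_two]

/-- The ray of `u uᵗ` is an exposed face of `CPₙ`, cut out by `orthoComplForm u`. -/
theorem eq_smul_rankOne_of_traceInner_eq_zero {n : ℕ} {u : Fin n → ℝ} (hu : u ≠ 0)
    {A : SymMat n} (hA : A ∈ CP n) (h : traceInner n A (orthoComplForm u) = 0) :
    ∃ c : ℝ, A = c • rankOne u := by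
  obtain ⟨m, B, -, hB⟩ := hA
  rw [traceInner_orthoComplForm u A B hB,
    Finset.sum_eq_zero_iff_of_nonneg fun k _ => dotProduct_cauchy_schwarz u _] at h
  have hd : u ⬝ᵥ u ≠ 0 := by simpa [dotProduct_self_eq_zero] using hu
  have hcol : ∀ i k, B i k = (u ⬝ᵥ B.col k) / (u ⬝ᵥ u) * u i := by
    intro i k
    have h0 := lagrange_identity_dotProduct u (B.col k)
    rw [h k (Finset.mem_univ k), mul_zero, dotProduct_self_eq_zero] at h0
    have h1 := congrFun h0 i
    simp only [Pi.sub_apply, Pi.smul_apply, smul_eq_mul, Pi.zero_apply, Matrix.col_apply] at h1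
    field_simp
    linarith
  -- Column `k` is `tₖ u`, so `B Bᵗ = (∑ tₖ²) u uᵗ`.
  refine ⟨∑ k, ((u ⬝ᵥ B.col k) / (u ⬝ᵥ u)) ^ 2, Subtype.ext ?_⟩
  ext i j
  rw [hB, Matrix.mul_apply, Submodule.coe_smul, Matrix.smul_apply, rankOne_apply, smul_eq_mul,
    Finset.sum_mul]
  refine Finset.sum_congr rfl fun k _ => ?_
  rw [Matrix.transpose_apply, hcol i k, hcol j k]
  ring

theorem HasZProperty.map_rankOne {n : ℕ} {L : SymMat n →ₗ[ℝ] SymMat n}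
    (hL : ∀ X ∈ CP n, L X ∈ CP n) (hZ : HasZProperty (traceInner n) (CP n) L)
    {u : Fin n → ℝ} (hu : ∀ i, 0 ≤ u i) : ∃ c : ℝ, L (rankOne u) = c • rankOne u := by
  rcases eq_or_ne u 0 with rfl | hu0
  · have h : rankOne (0 : Fin n → ℝ) = 0 := by
      ext i j
      simp [rankOne_apply]
    exact ⟨0, by simp [h]⟩
  have hmem := hL _ (rankOne_mem_CP hu)
  have hY := orthoComplForm_mem_dual u
  refine eq_smul_rankOne_of_traceInner_eq_zero hu0 hmem (le_antisymm ?_ ?_)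
  · exact hZ _ (rankOne_mem_CP hu) _ hY (traceInner_rankOne_orthoComplForm u)
  · exact PointedCone.mem_dual.1 hY hmem

/-- `t ↦ (u + t v)(u + t v)ᵗ` is quadratic with leading term `v vᵗ`, so its values at 0 and 1
determine the one at 2. -/
theorem rankOne_add_two_smul {n : ℕ} (u v : Fin n → ℝ) :
    rankOne (u + (2 : ℝ) • v) =
      (2 : ℝ) • rankOne (u + v) - rankOne u + (2 : ℝ) • rankOne v := by
  ext i j
  simp [rankOne_apply]
  ring

/-- The rank-one matrices attached to the coordinate vectors and their sums have a common
eigenvalue if all `rankOne u` with `u ≥ 0` are eigenvectors. -/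
theorem exists_common_eigenvalue {n : ℕ} {L : SymMat n →ₗ[ℝ] SymMat n}
    (h : ∀ u : Fin n → ℝ, (∀ i, 0 ≤ u i) → ∃ c : ℝ, L (rankOne u) = c • rankOne u)
    {i j : Fin n} (hij : i ≠ j) :
    ∃ c : ℝ, L (rankOne (Pi.single i 1)) = c • rankOne (Pi.single i 1) ∧
      L (rankOne (Pi.single j 1)) = c • rankOne (Pi.single j 1) ∧
      L (rankOne (Pi.single i 1 + Pi.single j 1)) =
        c • rankOne (Pi.single i 1 + Pi.single j 1) := by
  have hs : ∀ i : Fin n, (0 : Fin n → ℝ) ≤ Pi.single i 1 := fun i =>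
    Pi.single_nonneg.2 zero_le_one
  obtain ⟨a, ha⟩ := h (Pi.single i 1) (hs i)
  obtain ⟨b, hb⟩ := h (Pi.single j 1) (hs j)
  obtain ⟨c, hc⟩ := h (Pi.single i 1 + Pi.single j 1) (add_nonneg (hs i) (hs j))
  obtain ⟨d, hd⟩ := h (Pi.single i 1 + (2 : ℝ) • Pi.single j 1)
    (add_nonneg (hs i) (smul_nonneg zero_le_two (hs j)))
  have key := hd
  rw [rankOne_add_two_smul, map_add, map_sub, map_smul, map_smul, ha, hb, hc,
    ← rankOne_add_two_smul] at key
  have e : ∀ k l : Fin n, _ := fun k l => congrFun (congrFun (congrArg Subtype.val key) k) l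
  -- The three entries give `2c - a = d`, `2c = 2d` and `2c + 2b = 4d`, hence `a = b = c = d`.
  have e1 := e i i
  have e2 := e i j
  have e3 := e j j
  simp [rankOne_apply, hij, hij.symm] at e1 e2 e3
  obtain rfl : c = a := by linarith
  obtain rfl : c = b := by linarith
  exact ⟨c, ha, hb, hc⟩

/-- Polarization: each bracket is `eᵢ eⱼᵗ + eⱼ eᵢᵗ`. The factor 1/2 offsets the double count over
ordered pairs and the doubled diagonal. -/
theorem eq_sum_rankOne {n : ℕ} (X : SymMat n) :
    X = ∑ i, ∑ j, ((X : Matrix (Fin n) (Fin n) ℝ) i j / 2) •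
      (rankOne (Pi.single i 1 + Pi.single j 1) - rankOne (Pi.single i 1) -
        rankOne (Pi.single j 1)) := by
  ext k l
  have hX : (X : Matrix (Fin n) (Fin n) ℝ) l k = (X : Matrix (Fin n) (Fin n) ℝ) k l :=
    X.2.apply k l
  have h : ∀ i j : Fin n,
      ((((X : Matrix (Fin n) (Fin n) ℝ) i j / 2) •
        (rankOne (Pi.single i 1 + Pi.single j 1) - rankOne (Pi.single i 1) -
          rankOne (Pi.single j 1)) : SymMat n) : Matrix (Fin n) (Fin n) ℝ) k l =
      (if k = i then if l = j then (X : Matrix (Fin n) (Fin n) ℝ) i j / 2 else 0 else 0) +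
      (if l = i then if k = j then (X : Matrix (Fin n) (Fin n) ℝ) i j / 2 else 0 else 0) := by
    intro i j
    simp only [Submodule.coe_smul, Submodule.coe_sub, Matrix.smul_apply, Matrix.sub_apply,
      rankOne_apply, Pi.add_apply, Pi.single_apply, smul_eq_mul]
    split_ifs <;> ring
  simp only [Submodule.coe_sum, Matrix.sum_apply, h, Finset.sum_add_distrib]
  simp [hX]

theorem mainTheorem5 (n : ℕ) (hn : n ≤ 4) (L : SymMat n →ₗ[ℝ] SymMat n)
    (hL : ∀ X ∈ CP n, L X ∈ CP n) :
    HasZProperty (traceInner n) (CP n) L ↔ ∃ α : ℝ, 0 ≤ α ∧ ∀ X : SymMat n, L X = α • X := by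
  constructor
  · intro hZ
    rcases isEmpty_or_nonempty (Fin n) with hE | ⟨⟨i₀⟩⟩
    · refine ⟨0, le_rfl, fun X => ?_⟩
      ext i
      exact isEmptyElim i
    have hrank := fun (u : Fin n → ℝ) (hu : ∀ i, 0 ≤ u i) => hZ.map_rankOne hL hu
    have hs : ∀ i : Fin n, (0 : Fin n → ℝ) ≤ Pi.single i 1 := fun i =>
      Pi.single_nonneg.2 zero_le_one
    have hinj : ∀ (i : Fin n) (a b : ℝ),
        a • rankOne (Pi.single i 1) = b • rankOne (Pi.single i 1) → a = b := by
      intro i a b hab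
      simpa [rankOne_apply] using congrFun (congrFun (congrArg Subtype.val hab) i) i
    obtain ⟨α, hα⟩ := hrank (Pi.single i₀ 1) (hs i₀)
    have hdiag : ∀ i, L (rankOne (Pi.single i 1)) = α • rankOne (Pi.single i 1) := by
      intro i
      rcases eq_or_ne i₀ i with rfl | hi
      · exact hα
      obtain ⟨c, h1, h2, -⟩ := exists_common_eigenvalue hrank hi
      rwa [hinj i₀ α c (hα.symm.trans h1)]
    have hoff : ∀ i j, L (rankOne (Pi.single i 1 + Pi.single j 1)) =
        α • rankOne (Pi.single i 1 + Pi.single j 1) := by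
      intro i j
      rcases eq_or_ne i j with rfl | hij
      · have h4 : rankOne (Pi.single i 1 + Pi.single i 1 : Fin n → ℝ) =
            (4 : ℝ) • rankOne (Pi.single i 1) := by
          ext k l
          simp [rankOne_apply]
          ring
        rw [h4, map_smul, hdiag, smul_comm]
      obtain ⟨c, h1, -, h3⟩ := exists_common_eigenvalue hrank hij
      rwa [hinj i α c ((hdiag i).symm.trans h1)]
    refine ⟨α, ?_, fun X => ?_⟩
    -- `α` is a diagonal entry of a matrix `B Bᵗ`, hence a sum of squares.
    · obtain ⟨m, B, hB, hBe⟩ := hL _ (rankOne_mem_CP (hs i₀))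
      rw [hα] at hBe
      have h := congrFun (congrFun hBe i₀) i₀
      simp only [Submodule.coe_smul, Matrix.smul_apply, rankOne_apply, Pi.single_eq_same,
        smul_eq_mul, mul_one, Matrix.mul_apply, Matrix.transpose_apply] at h
      rw [h]
      exact Finset.sum_nonneg fun k _ => mul_self_nonneg _
    · rw [eq_sum_rankOne X]
      simp only [map_sum, map_smul, map_sub, hdiag, hoff, Finset.smul_sum]
      simp only [smul_comm α, smul_sub]
  · rintro ⟨α, -, h⟩ X - Y - hXY
    rw [h, map_smul, LinearMap.smul_apply, hXY, smul_zero]
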